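/- Let $c\in(0,1)$, $r=1-c^2$ and $s=5-4c^2$. Let $\phi:\mathbb R\to\mathbb R$ be a twice differentiable function that is positive, even, periodic (with some period $L>0$), non-constant, and satisfies $$-\phi''+\frac rs\,\phi-\frac1s\,(\phi^3+\phi^5)=0\quad\text{on }\mathbb R .$$ For $\alpha_4\in I=\left(\frac{-1+\sqrt{1+4r}}2,\ \frac{-3+\sqrt{9+48r}}4\right)$ put $\beta=-4\alpha_4^2-4\alpha_4+3+16r$ and $$\alpha_1=\frac{-2\alpha_4-3-\sqrt3\sqrt\beta}4,\quad \alpha_3=\frac{-2\alpha_4-3+\sqrt3\sqrt\beta}4,\quad k=\sqrt{\frac{-\alpha_1(\alpha_4-\alpha_3)}{\alpha_4(\alpha_3-\alpha_1)}},\quad b=\frac{\alpha_4}{-\alpha_1}k^2,\quad g=\frac2{\sqrt{\alpha_4(\alpha_3-\alpha_1)}},$$ and let $$\Phi_{\alpha_4}(x)=\frac{\sqrt{\alpha_4}\;\mathrm{dn}\!\left(\frac{2}{g\sqrt{3s}}x,k\right)}{\sqrt{1+b\,\mathrm{sn}^2\!\left(\frac{2}{g\sqrt{3s}}x,k\right)}},\qquad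 T_{\alpha_4}=\frac{2\sqrt{3s}\,K(k)}{\sqrt{\alpha_4(\alpha_3-\alpha_1)}},$$ where $\mathrm{sn}(\cdot,k)$, $\mathrm{dn}(\cdot,k)$ are the Jacobi elliptic functions of modulus $k$ and $K(k)$ is the complete elliptic integral of the first kind. Then there exists $\alpha_4\in I$ such that either * $\phi$ attains its maximum at $0$ and $\phi(x)=\Phi_{\alpha_4}(x)$ for all $x\in\mathbb R$, or * $\phi$ attains its minimum at $0$ and $\phi(x)=\Phi_{\alpha_4}(x+T_{\alpha_4}/2)$ for all $x\in\mathbb R$. -/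

import Mathlib

namespace DoubleDispersion

noncomputable section

/-! ### Jacobi elliptic functions of a real argument, with modulus `k ∈ [0, 1)` -/

/-- The incomplete elliptic integral of the first kind,
`F(θ, k) = ∫₀^θ dt / √(1 - k² sin² t)`. -/
def ellipticF (k θ : ℝ) : ℝ :=
  ∫ t in (0 : ℝ)..θ, 1 / √(1 - k ^ 2 * Real.sin t ^ 2)

/-- The complete elliptic integral of the first kind, `K(k) = F(π/2, k)`;
the substitution `x = sin t` turns it into `∫₀¹ dx / √((1 - k² x²)(1 - x²))`. -/
def ellipticK (k : ℝ) : ℝ := ellipticF k (Real.pi / 2)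

/-- The Jacobi amplitude `am(·, k)`, the inverse function of `θ ↦ F(θ, k)`, which is a bijection
of `ℝ` for `0 ≤ k < 1` (see `ellipticF_bijective` and `ellipticF_am` below). -/
def am (k u : ℝ) : ℝ := Function.invFun (ellipticF k) u

/-- `sn(u, k) = sin am(u, k)`. -/
def sn (k u : ℝ) : ℝ := Real.sin (am k u)

/-- `dn(u, k) = √(1 - k² sn²(u, k))`. -/
def dn (k u : ℝ) : ℝ := √(1 - k ^ 2 * sn k u ^ 2)

theorem one_sub_pos {k : ℝ} (h0 : 0 ≤ k) (h1 : k < 1) (t : ℝ) :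
    0 < 1 - k ^ 2 * Real.sin t ^ 2 := by
  have h2 : k ^ 2 < 1 := by nlinarith
  have h3 : Real.sin t ^ 2 ≤ 1 := Real.sin_sq_le_one t
  nlinarith [sq_nonneg k, sq_nonneg (Real.sin t)]

theorem ellipticF_bijective {k : ℝ} (h0 : 0 ≤ k) (h1 : k < 1) :
    Function.Bijective (ellipticF k) := by
  have hc : Continuous fun t : ℝ => 1 / √(1 - k ^ 2 * Real.sin t ^ 2) := by
    refine Continuous.div continuous_const (by fun_prop) fun t => ?_
    exact (Real.sqrt_pos.2 (one_sub_pos h0 h1 t)).ne'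
  have hge : ∀ t : ℝ, 1 ≤ 1 / √(1 - k ^ 2 * Real.sin t ^ 2) := fun t => by
    rw [le_div_iff₀ (Real.sqrt_pos.2 (one_sub_pos h0 h1 t)), one_mul]
    refine Real.sqrt_le_iff.2 ⟨zero_le_one, ?_⟩
    nlinarith [mul_nonneg (sq_nonneg k) (sq_nonneg (Real.sin t))]
  have hd : ∀ x, HasDerivAt (ellipticF k) (1 / √(1 - k ^ 2 * Real.sin x ^ 2)) x := fun x =>
    intervalIntegral.integral_hasDerivAt_right (hc.intervalIntegrable _ _)
      (hc.stronglyMeasurableAtFilter _ _) hc.continuousAt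
  have hcont : Continuous (ellipticF k) :=
    continuous_iff_continuousAt.2 fun x => (hd x).continuousAt
  have hm : Monotone fun x => ellipticF k x - x := by
    have hd' : ∀ x, HasDerivAt (fun x => ellipticF k x - x)
        (1 / √(1 - k ^ 2 * Real.sin x ^ 2) - 1) x := fun x => (hd x).sub (hasDerivAt_id x)
    refine monotone_of_deriv_nonneg (fun x => (hd' x).differentiableAt) ?_
    intro x
    rw [(hd' x).deriv]
    linarith [hge x]
  have hzero : ellipticF k 0 = 0 := by simp [ellipticF]
  refine ⟨StrictMono.injective fun x y hxy => ?_, hcont.surjective ?_ ?_⟩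
  · have h2 : ellipticF k x - x ≤ ellipticF k y - y := hm hxy.le
    linarith
  · refine Filter.tendsto_atTop_mono' _ ?_ Filter.tendsto_id
    filter_upwards [Filter.eventually_ge_atTop (0 : ℝ)] with x hx
    have h2 : ellipticF k 0 - 0 ≤ ellipticF k x - x := hm hx
    simp only [id]
    linarith
  · refine Filter.tendsto_atBot_mono' _ ?_ Filter.tendsto_id
    filter_upwards [Filter.eventually_le_atBot (0 : ℝ)] with x hx
    have h2 : ellipticF k x - x ≤ ellipticF k 0 - 0 := hm hx
    simp only [id]
    linarith

theorem ellipticF_am {k : ℝ} (h0 : 0 ≤ k) (h1 : k < 1) (u : ℝ) : ellipticF k (am k u) = u :=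
  Function.rightInverse_invFun (ellipticF_bijective h0 h1).2 u

/-! ### The travelling wave equation and the dnoidal profile -/

/-- `r = 1 - c²`. -/
def rr (c : ℝ) : ℝ := 1 - c ^ 2

/-- `s = 5 - 4 c²`. -/
def ss (c : ℝ) : ℝ := 5 - 4 * c ^ 2

/-- `φ : ℝ → ℝ` is a (classical) solution of `-φ'' + (r/s) φ - (1/s) (φ³ + φ⁵) = 0` on `ℝ`. -/
def IsSolution (c : ℝ) (φ : ℝ → ℝ) : Prop :=
  Differentiable ℝ φ ∧ Differentiable ℝ (deriv φ) ∧
    ∀ x, -deriv (deriv φ) x + rr c / ss c * φ x - 1 / ss c * (φ x ^ 3 + φ x ^ 5) = 0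

/-- The open interval of admissible values of the largest root `α₄`. -/
def rootInterval (c : ℝ) : Set ℝ :=
  Set.Ioo ((-1 + √(1 + 4 * rr c)) / 2) ((-3 + √(9 + 48 * rr c)) / 4)

/-- The discriminant `β = -4 α₄² - 4 α₄ + 3 + 16 r`. -/
def disc (c a : ℝ) : ℝ := -4 * a ^ 2 - 4 * a + 3 + 16 * rr c

/-- The negative root `α₁`, as a function of `α₄ = a`. -/
def alpha1 (c a : ℝ) : ℝ := (-2 * a - 3 - √3 * √(disc c a)) / 4

/-- The intermediate root `α₃`, as a function of `α₄ = a`. -/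
def alpha3 (c a : ℝ) : ℝ := (-2 * a - 3 + √3 * √(disc c a)) / 4

/-- The elliptic modulus, `k² = -α₁ (α₄ - α₃) / (α₄ (α₃ - α₁))`. -/
def modulus (c a : ℝ) : ℝ :=
  √(-alpha1 c a * (a - alpha3 c a) / (a * (alpha3 c a - alpha1 c a)))

/-- The coefficient `β² = (α₄ / (-α₁)) k²`. -/
def betaSq (c a : ℝ) : ℝ := a / (-alpha1 c a) * modulus c a ^ 2

/-- The constant `g = 2 / √(α₄ (α₃ - α₁))`. -/
def gg (c a : ℝ) : ℝ := 2 / √(a * (alpha3 c a - alpha1 c a))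

/-- The period `T = 2 √(3 s) K(k) / √(α₄ (α₃ - α₁))` of the dnoidal wave. -/
def period (c a : ℝ) : ℝ :=
  2 * √(3 * ss c) * ellipticK (modulus c a) / √(a * (alpha3 c a - alpha1 c a))

/-- The dnoidal wave
`√α₄ dn(2x / (g √(3s)), k) / √(1 + β² sn²(2x / (g √(3s)), k))`. -/
def dnoidalWave (c a x : ℝ) : ℝ :=
  √a * dn (modulus c a) (2 / (gg c a * √(3 * ss c)) * x) /
    √(1 + betaSq c a * sn (modulus c a) (2 / (gg c a * √(3 * ss c)) * x) ^ 2)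

end

end DoubleDispersion

namespace DoubleDispersion

open Set

/-! ### Calculus of the Jacobi functions -/

/-! The equation has the first integral `s φ'² - r φ² + φ⁴/2 + φ⁶/3`, so at every critical point of
`φ` the number `u = φ²` is a root of one fixed cubic. The squares `n < a` of the minimum and maximum
are two of its roots, and the third, `-(a + n + 3/2)`, is negative. Hence `φ` has only two critical
values, and since `φ'(0) = 0` by evenness, `φ(0)` is the minimum or the maximum. The dnoidal wave
built from `a` solves the same equation, with zero slope and value `√a` at `0`, `√n` at half its
period. Uniqueness for the initial value problem (`eq_of_hasDerivAt_of_hasDerivAt`) identifies it,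
suitably shifted, with `φ`. -/

theorem hasDerivAt_ellipticF {k : ℝ} (h0 : 0 ≤ k) (h1 : k < 1) (x : ℝ) :
    HasDerivAt (ellipticF k) (1 / √(1 - k ^ 2 * Real.sin x ^ 2)) x := by
  have hc : Continuous fun t : ℝ => 1 / √(1 - k ^ 2 * Real.sin t ^ 2) := by
    refine Continuous.div continuous_const (by fun_prop) fun t => ?_
    exact (Real.sqrt_pos.2 (one_sub_pos h0 h1 t)).ne'
  exact intervalIntegral.integral_hasDerivAt_right (hc.intervalIntegrable _ _)
    (hc.stronglyMeasurableAtFilter _ _) hc.continuousAt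

theorem strictMono_ellipticF {k : ℝ} (h0 : 0 ≤ k) (h1 : k < 1) : StrictMono (ellipticF k) := by
  refine strictMono_of_deriv_pos fun x => ?_
  rw [(hasDerivAt_ellipticF h0 h1 x).deriv]
  exact one_div_pos.2 (Real.sqrt_pos.2 (one_sub_pos h0 h1 x))

theorem am_ellipticF {k : ℝ} (h0 : 0 ≤ k) (h1 : k < 1) (t : ℝ) : am k (ellipticF k t) = t :=
  Function.leftInverse_invFun (ellipticF_bijective h0 h1).1 t

/-- A monotone surjection of `ℝ` is continuous; continuity is what the inverse function rule for
`am` needs. -/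
theorem continuous_am {k : ℝ} (h0 : 0 ≤ k) (h1 : k < 1) : Continuous (am k) := by
  have hm : Monotone (am k) := fun u v huv => by
    rw [← (strictMono_ellipticF h0 h1).le_iff_le, ellipticF_am h0 h1, ellipticF_am h0 h1]
    exact huv
  exact hm.continuous_of_surjective fun t => ⟨_, am_ellipticF h0 h1 t⟩

theorem hasDerivAt_am {k : ℝ} (h0 : 0 ≤ k) (h1 : k < 1) (u : ℝ) :
    HasDerivAt (am k) (dn k u) u := by
  have hd : 0 < dn k u := Real.sqrt_pos.2 (one_sub_pos h0 h1 _)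
  have h := HasDerivAt.of_local_left_inverse (continuous_am h0 h1).continuousAt
    (hasDerivAt_ellipticF h0 h1 (am k u)) (one_div_pos.2 hd).ne'
    (Filter.Eventually.of_forall (ellipticF_am h0 h1))
  simpa [dn, sn] using h

/-- The Jacobi function `cn(u, k) = cos am(u, k)`. -/
noncomputable def cn (k u : ℝ) : ℝ := Real.cos (am k u)

theorem sn_sq_add_cn_sq (k u : ℝ) : sn k u ^ 2 + cn k u ^ 2 = 1 := Real.sin_sq_add_cos_sq _

theorem dn_pos {k : ℝ} (h0 : 0 ≤ k) (h1 : k < 1) (u : ℝ) : 0 < dn k u :=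
  Real.sqrt_pos.2 (one_sub_pos h0 h1 _)

theorem dn_sq {k : ℝ} (h0 : 0 ≤ k) (h1 : k < 1) (u : ℝ) :
    dn k u ^ 2 = 1 - k ^ 2 * sn k u ^ 2 :=
  Real.sq_sqrt (one_sub_pos h0 h1 _).le

theorem hasDerivAt_sn {k : ℝ} (h0 : 0 ≤ k) (h1 : k < 1) (u : ℝ) :
    HasDerivAt (sn k) (cn k u * dn k u) u :=
  (hasDerivAt_am h0 h1 u).sin

theorem hasDerivAt_cn {k : ℝ} (h0 : 0 ≤ k) (h1 : k < 1) (u : ℝ) :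
    HasDerivAt (cn k) (-sn k u * dn k u) u :=
  (hasDerivAt_am h0 h1 u).cos

theorem hasDerivAt_dn {k : ℝ} (h0 : 0 ≤ k) (h1 : k < 1) (u : ℝ) :
    HasDerivAt (dn k) (-k ^ 2 * sn k u * cn k u) u := by
  have hd := dn_pos h0 h1 u
  have h := ((((hasDerivAt_sn h0 h1 u).pow 2).const_mul (k ^ 2)).const_sub 1).sqrt
    (one_sub_pos h0 h1 (am k u)).ne'
  refine h.congr_deriv ?_
  change _ / (2 * dn k u) = _
  field_simp
  norm_num
  ring

theorem am_zero {k : ℝ} (h0 : 0 ≤ k) (h1 : k < 1) : am k 0 = 0 := by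
  simpa [ellipticF] using am_ellipticF h0 h1 0

theorem am_ellipticK {k : ℝ} (h0 : 0 ≤ k) (h1 : k < 1) : am k (ellipticK k) = Real.pi / 2 :=
  am_ellipticF h0 h1 _

/-! ### The profile `dn / √(1 + b sn²)` -/

theorem hasDerivAt_sqrt_one_add_mul_sn_sq {k b : ℝ} (h0 : 0 ≤ k) (h1 : k < 1) (hb : 0 ≤ b)
    (u : ℝ) : HasDerivAt (fun u => √(1 + b * sn k u ^ 2))
      (b * sn k u * cn k u * dn k u / √(1 + b * sn k u ^ 2)) u := by
  have hq : 0 < 1 + b * sn k u ^ 2 := by positivity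
  have h := ((((hasDerivAt_sn h0 h1 u).pow 2).const_mul b).const_add 1).sqrt hq.ne'
  refine h.congr_deriv ?_
  have := Real.sqrt_pos.2 hq
  simp only [Pi.pow_apply]
  field_simp
  norm_num
  ring

theorem hasDerivAt_profile {k b : ℝ} (h0 : 0 ≤ k) (h1 : k < 1) (hb : 0 ≤ b) (u : ℝ) :
    HasDerivAt (fun u => dn k u / √(1 + b * sn k u ^ 2))
      (-(k ^ 2 + b) * (sn k u * cn k u / √(1 + b * sn k u ^ 2) ^ 3)) u := by
  have hq : 0 < 1 + b * sn k u ^ 2 := by positivity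
  have hs := Real.sqrt_pos.2 hq
  refine ((hasDerivAt_dn h0 h1 u).div (hasDerivAt_sqrt_one_add_mul_sn_sq h0 h1 hb u)
    hs.ne').congr_deriv ?_
  have e1 := dn_sq h0 h1 u
  have e2 := Real.sq_sqrt hq.le
  generalize √(1 + b * sn k u ^ 2) = q at *
  field_simp
  linear_combination (-(sn k u * cn k u * b)) * e1 - (sn k u * cn k u * k ^ 2) * e2

theorem hasDerivAt_deriv_profile {k b : ℝ} (h0 : 0 ≤ k) (h1 : k < 1) (hb : 0 ≤ b) (u : ℝ) :
    HasDerivAt (fun u => sn k u * cn k u / √(1 + b * sn k u ^ 2) ^ 3)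
      (dn k u / √(1 + b * sn k u ^ 2) ^ 5 *
        (1 - 2 * (1 + b) * sn k u ^ 2 + b * sn k u ^ 4)) u := by
  have hq : 0 < 1 + b * sn k u ^ 2 := by positivity
  have hs := Real.sqrt_pos.2 hq
  refine (((hasDerivAt_sn h0 h1 u).mul (hasDerivAt_cn h0 h1 u)).div
    ((hasDerivAt_sqrt_one_add_mul_sn_sq h0 h1 hb u).pow 3) (pow_pos hs 3).ne').congr_deriv ?_
  have e1 : cn k u ^ 2 = 1 - sn k u ^ 2 := by linear_combination sn_sq_add_cn_sq k u
  have e2 := Real.sq_sqrt hq.le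
  simp only [Pi.pow_apply, Pi.mul_apply]
  generalize √(1 + b * sn k u ^ 2) = q at *
  field_simp
  norm_num
  linear_combination dn k u * q ^ 2 * (q ^ 2 - 3 * b * sn k u ^ 2) * e1 +
    dn k u * q ^ 2 * (1 - 2 * sn k u ^ 2) * e2

/-! ### Uniqueness for the second-order equation -/

/-- The planar field `v` is only locally Lipschitz. Over a bounded interval both trajectories stay
in one closed ball, which is compact and convex, so `v` is Lipschitz there. -/
theorem eq_of_hasDerivAt_of_hasDerivAt {F : ℝ → ℝ} (hF : ContDiff ℝ 1 F) {f f' g g' : ℝ → ℝ}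
    (hf : ∀ x, HasDerivAt f (f' x) x) (hf' : ∀ x, HasDerivAt f' (F (f x)) x)
    (hg : ∀ x, HasDerivAt g (g' x) x) (hg' : ∀ x, HasDerivAt g' (F (g x)) x)
    {x₀ : ℝ} (h : f x₀ = g x₀) (h' : f' x₀ = g' x₀) (x : ℝ) : f x = g x := by
  set v : ℝ × ℝ → ℝ × ℝ := fun p => (p.2, F p.1) with hv
  have hvc : ContDiff ℝ 1 v := contDiff_snd.prodMk (hF.comp contDiff_fst)
  set N : ℝ := |x| + |x₀| + 1
  have hP : ∀ t, HasDerivAt (fun t => (f t, f' t)) (v (f t, f' t)) t :=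
    fun t => (hf t).prodMk (hf' t)
  have hQ : ∀ t, HasDerivAt (fun t => (g t, g' t)) (v (g t, g' t)) t :=
    fun t => (hg t).prodMk (hg' t)
  have hPc : Continuous fun t => (f t, f' t) :=
    continuous_iff_continuousAt.2 fun t => (hP t).continuousAt
  have hQc : Continuous fun t => (g t, g' t) :=
    continuous_iff_continuousAt.2 fun t => (hQ t).continuousAt
  have hbdd := ((isCompact_Icc (a := -N) (b := N)).image hPc).isBounded.union
    ((isCompact_Icc (a := -N) (b := N)).image hQc).isBounded
  obtain ⟨R, hR⟩ := hbdd.subset_closedBall 0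
  obtain ⟨K, hK⟩ := hvc.contDiffOn.exists_lipschitzOnWith one_ne_zero
    (convex_closedBall (0 : ℝ × ℝ) R) (isCompact_closedBall _ _)
  have hmem : ∀ y, |y| < N → y ∈ Ioo (-N) N := fun y hy => abs_lt.1 hy
  have hx := hmem x (by have := abs_nonneg x₀; linarith)
  have hx₀ := hmem x₀ (by have := abs_nonneg x; linarith)
  have key := ODE_solution_unique_of_mem_Ioo (v := fun _ => v)
    (s := fun _ => Metric.closedBall 0 R) (fun _ _ => hK) hx₀
    (fun t ht => ⟨hP t, hR (Or.inl (mem_image_of_mem _ (Ioo_subset_Icc_self ht)))⟩)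
    (fun t ht => ⟨hQ t, hR (Or.inr (mem_image_of_mem _ (Ioo_subset_Icc_self ht)))⟩)
    (Prod.ext h h') hx
  exact congrArg Prod.fst key

/-! ### The dnoidal wave in terms of the roots -/

/-- The intermediate root `n` and the largest root `a` of the cubic
`-u³ - (3/2) u² + 3 r u + C`, whose third root is then `-(a + n + 3/2)`. -/
structure IsRootPair (c a n : ℝ) : Prop where
  pos : 0 < n
  lt : n < a
  rr_eq : 3 * rr c = a ^ 2 + n ^ 2 + n * a + 3 / 2 * a + 3 / 2 * n

namespace IsRootPair

variable {c a n : ℝ}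

/-- The right side of `rr_eq` increases with `n > 0`; its limiting cases `n = a` and `n = 0` give
the lower and upper endpoints for `a`. -/
theorem mem_rootInterval (h : IsRootPair c a n) : a ∈ rootInterval c := by
  obtain ⟨hn, ha, hr⟩ := h
  constructor
  · have : √(1 + 4 * rr c) < 2 * a + 1 := by
      rw [Real.sqrt_lt' (by linarith)]
      nlinarith
    linarith
  · have : 4 * a + 3 < √(9 + 48 * rr c) := by
      apply Real.lt_sqrt_of_sq_lt
      nlinarith
    linarith

/-- By `rr_eq`, three times the discriminant is a perfect square; the positive square root makes
`alpha3` the root `n`. -/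
theorem sqrt_disc (h : IsRootPair c a n) : √3 * √(disc c a) = 4 * n + 2 * a + 3 := by
  obtain ⟨hn, ha, hr⟩ := h
  rw [← Real.sqrt_mul (by norm_num), Real.sqrt_eq_iff_mul_self_eq_of_pos (by linarith), disc]
  linear_combination -16 * hr

theorem alpha1_eq (h : IsRootPair c a n) : alpha1 c a = -(a + n + 3 / 2) := by
  rw [alpha1, h.sqrt_disc]
  ring

theorem alpha3_eq (h : IsRootPair c a n) : alpha3 c a = n := by
  rw [alpha3, h.sqrt_disc]
  ring

theorem modulus_sq (h : IsRootPair c a n) :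
    modulus c a ^ 2 = (a + n + 3 / 2) * (a - n) / (a * (a + 2 * n + 3 / 2)) := by
  have hn := h.pos
  have ha := h.lt
  rw [modulus, h.alpha1_eq, h.alpha3_eq, Real.sq_sqrt]
  · ring_nf
  · have : 0 < a := hn.trans ha
    have h1 : 0 ≤ a - n := by linarith
    have h2 : 0 ≤ n - -(a + n + 3 / 2) := by linarith
    rw [neg_neg]
    positivity

theorem one_sub_modulus_sq (h : IsRootPair c a n) :
    1 - modulus c a ^ 2 = n * (2 * a + n + 3 / 2) / (a * (a + 2 * n + 3 / 2)) := by
  have hn := h.pos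
  have : 0 < a := hn.trans h.lt
  rw [h.modulus_sq]
  field_simp
  ring

theorem modulus_nonneg (_ : IsRootPair c a n) : 0 ≤ modulus c a := Real.sqrt_nonneg _

theorem modulus_lt_one (h : IsRootPair c a n) : modulus c a < 1 := by
  have hn := h.pos
  have : 0 < a := hn.trans h.lt
  have h1 : 0 < 1 - modulus c a ^ 2 := by
    rw [h.one_sub_modulus_sq]
    positivity
  nlinarith [h.modulus_nonneg]

theorem betaSq_eq (h : IsRootPair c a n) : betaSq c a = (a - n) / (a + 2 * n + 3 / 2) := by
  have hn := h.pos
  have : 0 < a := hn.trans h.lt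
  rw [betaSq, h.modulus_sq, h.alpha1_eq, neg_neg]
  field_simp

theorem betaSq_nonneg (h : IsRootPair c a n) : 0 ≤ betaSq c a := by
  have hn := h.pos
  have ha := h.lt
  rw [h.betaSq_eq]
  exact div_nonneg (by linarith) (by linarith)

theorem frequency_sq (h : IsRootPair c a n) (hs : 0 < ss c) :
    (2 / (gg c a * √(3 * ss c))) ^ 2 = a * (a + 2 * n + 3 / 2) / (3 * ss c) := by
  have hn := h.pos
  have : 0 < a := hn.trans h.lt
  have h1 : n - -(a + n + 3 / 2) = a + 2 * n + 3 / 2 := by ring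
  rw [gg, h.alpha1_eq, h.alpha3_eq, h1, div_pow, mul_pow, div_pow, Real.sq_sqrt (by positivity),
    Real.sq_sqrt (by positivity)]
  field_simp

theorem frequency_mul_half_period (h : IsRootPair c a n) (hs : 0 < ss c) :
    2 / (gg c a * √(3 * ss c)) * (period c a / 2) = ellipticK (modulus c a) := by
  have hn := h.pos
  have : 0 < a := hn.trans h.lt
  have h1 : 0 < a * (alpha3 c a - alpha1 c a) := by
    rw [h.alpha1_eq, h.alpha3_eq]
    have : 0 < n - -(a + n + 3 / 2) := by linarith
    positivity
  have h2 := Real.sqrt_pos.2 h1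
  have h3 : 0 < √(3 * ss c) := by positivity
  rw [gg, period]
  field_simp

/-- With `x = sn²`, this is the wave equation for the profile after cancelling `√a dn` and clearing
the powers of `√(1 + b sn²)`. -/
theorem profile_identity (h : IsRootPair c a n) (x : ℝ) :
    -(modulus c a ^ 2 + betaSq c a) * (a * (a + 2 * n + 3 / 2) / 3) *
        (1 - 2 * (1 + betaSq c a) * x + betaSq c a * x ^ 2) =
      rr c * (1 + betaSq c a * x) ^ 2
        - a * (1 - modulus c a ^ 2 * x) * (1 + betaSq c a * x)
        - a ^ 2 * (1 - modulus c a ^ 2 * x) ^ 2 := by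
  have hn := h.pos
  have : 0 < a := hn.trans h.lt
  have hr : rr c = (a ^ 2 + n ^ 2 + n * a + 3 / 2 * a + 3 / 2 * n) / 3 := by
    linarith [h.rr_eq]
  rw [h.betaSq_eq, h.modulus_sq, hr]
  field_simp
  ring

end IsRootPair

/-- The derivative of the dnoidal wave. -/
noncomputable def dnoidalWaveDeriv (c a x : ℝ) : ℝ :=
  √a * (-(modulus c a ^ 2 + betaSq c a) *
    (sn (modulus c a) (2 / (gg c a * √(3 * ss c)) * x) *
      cn (modulus c a) (2 / (gg c a * √(3 * ss c)) * x) /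
      √(1 + betaSq c a * sn (modulus c a) (2 / (gg c a * √(3 * ss c)) * x) ^ 2) ^ 3)) *
    (2 / (gg c a * √(3 * ss c)))

namespace IsRootPair

variable {c a n : ℝ}

theorem hasDerivAt_dnoidalWave (h : IsRootPair c a n) (x : ℝ) :
    HasDerivAt (dnoidalWave c a) (dnoidalWaveDeriv c a x) x := by
  set l := 2 / (gg c a * √(3 * ss c)) with hl
  have hlin : HasDerivAt (fun x => l * x) l x := by simpa using (hasDerivAt_id x).const_mul l
  have h1 := ((hasDerivAt_profile h.modulus_nonneg h.modulus_lt_one h.betaSq_nonneg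
    (l * x)).comp x hlin).const_mul √a
  refine (h1.congr_deriv ?_).congr_of_eventuallyEq (Filter.Eventually.of_forall fun y => ?_)
  · rw [dnoidalWaveDeriv]
    ring
  · simp only [dnoidalWave, Function.comp_apply, mul_div_assoc, hl]

theorem hasDerivAt_dnoidalWaveDeriv (h : IsRootPair c a n) (hs : 0 < ss c) (x : ℝ) :
    HasDerivAt (dnoidalWaveDeriv c a)
      (rr c / ss c * dnoidalWave c a x -
        1 / ss c * (dnoidalWave c a x ^ 3 + dnoidalWave c a x ^ 5)) x := by
  have ha : 0 < a := h.pos.trans h.lt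
  have hl2 := h.frequency_sq hs
  set l := 2 / (gg c a * √(3 * ss c)) with hl
  have hlin : HasDerivAt (fun x => l * x) l x := by simpa using (hasDerivAt_id x).const_mul l
  have h1 := ((((hasDerivAt_deriv_profile h.modulus_nonneg h.modulus_lt_one h.betaSq_nonneg
    (l * x)).comp x hlin).const_mul (-(modulus c a ^ 2 + betaSq c a))).const_mul √a).mul_const l
  refine h1.congr_deriv ?_
  have hid := h.profile_identity (sn (modulus c a) (l * x) ^ 2)
  have hd := dn_sq h.modulus_nonneg h.modulus_lt_one (l * x)
  have hb := h.betaSq_nonneg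
  have hq0 : 0 < 1 + betaSq c a * sn (modulus c a) (l * x) ^ 2 := by positivity
  have hq := Real.sq_sqrt hq0.le
  have hqpos := Real.sqrt_pos.2 hq0
  have ha2 := Real.sq_sqrt ha.le
  rw [dnoidalWave, ← hl]
  generalize √(1 + betaSq c a * sn (modulus c a) (l * x) ^ 2) = q at *
  clear h1
  clear_value l
  generalize √a = m at *
  generalize dn (modulus c a) (l * x) = d at *
  generalize sn (modulus c a) (l * x) = S at *
  generalize modulus c a = k at *
  generalize betaSq c a = b at *
  -- Written in `q`, `d`, `m`, `l`, the profile identity times `m * d` is the goal cleared of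
  -- denominators.
  rw [← hq, ← hd, ← ha2] at hid
  have hl3 : l ^ 2 * ss c = m ^ 2 * (m ^ 2 + 2 * n + 3 / 2) / 3 := by
    rw [hl2, ha2]
    field_simp
  rw [← hl3] at hid
  field_simp
  linear_combination m * d * hid

theorem dnoidalWave_zero (h : IsRootPair c a n) : dnoidalWave c a 0 = √a := by
  simp [dnoidalWave, dn, sn, am_zero h.modulus_nonneg h.modulus_lt_one]

theorem dnoidalWaveDeriv_zero (h : IsRootPair c a n) : dnoidalWaveDeriv c a 0 = 0 := by
  simp [dnoidalWaveDeriv, sn, am_zero h.modulus_nonneg h.modulus_lt_one]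

theorem dnoidalWave_half_period (h : IsRootPair c a n) (hs : 0 < ss c) :
    dnoidalWave c a (period c a / 2) = √n := by
  have hn := h.pos
  have ha : 0 < a := hn.trans h.lt
  have h1 : sn (modulus c a) (ellipticK (modulus c a)) = 1 := by
    rw [sn, am_ellipticK h.modulus_nonneg h.modulus_lt_one, Real.sin_pi_div_two]
  have hb := h.betaSq_nonneg
  rw [dnoidalWave, h.frequency_mul_half_period hs, dn, h1, one_pow, mul_one, mul_one,
    ← Real.sqrt_mul ha.le, ← Real.sqrt_div' _ (by positivity), h.one_sub_modulus_sq, h.betaSq_eq]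
  congr 1
  have h2 : 1 + (a - n) / (a + 2 * n + 3 / 2) = (2 * a + n + 3 / 2) / (a + 2 * n + 3 / 2) := by
    field_simp
    ring
  rw [h2]
  field_simp

theorem dnoidalWaveDeriv_half_period (h : IsRootPair c a n) (hs : 0 < ss c) :
    dnoidalWaveDeriv c a (period c a / 2) = 0 := by
  have h1 : cn (modulus c a) (ellipticK (modulus c a)) = 0 := by
    rw [cn, am_ellipticK h.modulus_nonneg h.modulus_lt_one, Real.cos_pi_div_two]
  rw [dnoidalWaveDeriv, h.frequency_mul_half_period hs, h1]
  simp

/-- The shift `μ` covers both cases: `0` for a maximum at the origin, half a period for a minimum.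
-/
theorem eq_dnoidalWave (h : IsRootPair c a n) (hs : 0 < ss c) {φ : ℝ → ℝ}
    (hsol : IsSolution c φ) (μ : ℝ) (h0 : φ 0 = dnoidalWave c a μ)
    (h1 : deriv φ 0 = dnoidalWaveDeriv c a μ) (x : ℝ) : φ x = dnoidalWave c a (x + μ) := by
  obtain ⟨hφ, hφ', hode⟩ := hsol
  have hF : ContDiff ℝ 1 fun y : ℝ => rr c / ss c * y - 1 / ss c * (y ^ 3 + y ^ 5) := by fun_prop
  refine eq_of_hasDerivAt_of_hasDerivAt (f := φ) (f' := deriv φ)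
    (g := fun x => dnoidalWave c a (x + μ)) (g' := fun x => dnoidalWaveDeriv c a (x + μ))
    hF (fun x => (hφ x).hasDerivAt)
    (fun x => (hφ' x).hasDerivAt.congr_deriv (by linarith [hode x]))
    (fun x => (h.hasDerivAt_dnoidalWave (x + μ)).comp_add_const x μ)
    (fun x => (h.hasDerivAt_dnoidalWaveDeriv hs (x + μ)).comp_add_const x μ) (x₀ := 0) ?_ ?_ x
  · simpa using h0
  · simpa using h1

end IsRootPair

/-! ### First integral -/

theorem IsSolution.energy_eq {c : ℝ} (hs : 0 < ss c) {φ : ℝ → ℝ} (hsol : IsSolution c φ)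
    (x y : ℝ) :
    ss c * deriv φ x ^ 2 - rr c * φ x ^ 2 + φ x ^ 4 / 2 + φ x ^ 6 / 3 =
      ss c * deriv φ y ^ 2 - rr c * φ y ^ 2 + φ y ^ 4 / 2 + φ y ^ 6 / 3 := by
  obtain ⟨hφ, hφ', hode⟩ := hsol
  have hd : ∀ x, HasDerivAt (fun x => ss c * deriv φ x ^ 2 - rr c * φ x ^ 2 + φ x ^ 4 / 2 +
      φ x ^ 6 / 3) 0 x := fun x => by
    have h1 := (hφ x).hasDerivAt
    have h2 := (hφ' x).hasDerivAt
    refine (((((h2.pow 2).const_mul (ss c)).sub ((h1.pow 2).const_mul (rr c))).add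
      ((h1.pow 4).div_const 2)).add ((h1.pow 6).div_const 3)).congr_deriv ?_
    have h3 := hode x
    field_simp at h3
    norm_num
    linear_combination -2 * deriv φ x * h3
  exact is_const_of_deriv_eq_zero (fun x => (hd x).differentiableAt) (fun x => (hd x).deriv) x y

/-- At two critical points with distinct values, the squares of the values are a root pair. -/
theorem IsSolution.isRootPair {c : ℝ} (hs : 0 < ss c) {φ : ℝ → ℝ} (hsol : IsSolution c φ)
    {x y : ℝ} (hx : deriv φ x = 0) (hy : deriv φ y = 0) (hpos : 0 < φ x) (hlt : φ x < φ y) :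
    IsRootPair c (φ y ^ 2) (φ x ^ 2) := by
  have hsq : φ x ^ 2 < φ y ^ 2 := by gcongr
  refine ⟨by positivity, hsq, ?_⟩
  have h := hsol.energy_eq hs x y
  rw [hx, hy] at h
  -- The difference of the two energies is divisible by the difference of the roots; the quotient is
  -- `rr_eq`.
  refine mul_left_cancel₀ (sub_pos.2 hsq).ne' ?_
  linear_combination 3 * h

theorem IsSolution.eq_or_eq_of_deriv_eq_zero {c : ℝ} (hs : 0 < ss c) {φ : ℝ → ℝ}
    (hsol : IsSolution c φ) (hpos : ∀ x, 0 < φ x) {x y z : ℝ} (hx : deriv φ x = 0)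
    (hy : deriv φ y = 0) (hz : deriv φ z = 0) (hlt : φ x < φ y) : φ z = φ x ∨ φ z = φ y := by
  by_contra! hne
  obtain ⟨hzx, hzy⟩ := hne
  have h1 := (hsol.isRootPair hs hx hy (hpos x) hlt).rr_eq
  have hz0 := hpos z
  have hx0 := hpos x
  have hy0 := hpos y
  -- The relation is symmetric in the two roots, so the order of `φ z` and `φ x` is immaterial.
  -- Subtracting it from `h1` would force three positive roots to sum to `-3/2`.
  have h2 : 3 * rr c = φ z ^ 4 + φ x ^ 4 + φ x ^ 2 * φ z ^ 2 + 3 / 2 * φ z ^ 2 + 3 / 2 * φ x ^ 2 := by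
    rcases lt_or_gt_of_ne hzx with h | h
    · linear_combination (hsol.isRootPair hs hz hx hz0 h).rr_eq
    · linear_combination (hsol.isRootPair hs hx hz hx0 h).rr_eq
  have hne2 : φ z ^ 2 - φ y ^ 2 ≠ 0 := fun h => hzy (by
    rwa [sub_eq_zero, pow_left_inj₀ hz0.le hy0.le two_ne_zero] at h)
  have h3 : (φ z ^ 2 - φ y ^ 2) * (φ z ^ 2 + φ y ^ 2 + φ x ^ 2 + 3 / 2) = 0 := by
    linear_combination h1 - h2
  have h4 : 0 < φ z ^ 2 + φ y ^ 2 + φ x ^ 2 + 3 / 2 := by positivity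
  exact (mul_ne_zero hne2 h4.ne') h3

theorem _root_.Function.Even.deriv_zero {φ : ℝ → ℝ} (h : Function.Even φ) : deriv φ 0 = 0 := by
  have h1 := deriv_comp_neg φ 0
  have h2 : (fun x => φ (-x)) = φ := funext h
  rw [h2, neg_zero] at h1
  linarith

theorem _root_.Function.Periodic.exists_forall_ge_and_forall_le {φ : ℝ → ℝ} {L : ℝ}
    (h : Function.Periodic φ L) (hL : 0 < L) (hc : Continuous φ) :
    ∃ x y, (∀ z, φ x ≤ φ z) ∧ ∀ z, φ z ≤ φ y := by
  have hcomp := h.compact_of_continuous hL.ne' hc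
  obtain ⟨_, ⟨x, rfl⟩, hx⟩ := hcomp.exists_isLeast (range_nonempty φ)
  obtain ⟨_, ⟨y, rfl⟩, hy⟩ := hcomp.exists_isGreatest (range_nonempty φ)
  exact ⟨x, y, fun z => hx (mem_range_self z), fun z => hy (mem_range_self z)⟩

end DoubleDispersion

open DoubleDispersion

theorem proposition3p2 (c : ℝ) (hc : c ∈ Set.Ioo (0 : ℝ) 1) (φ : ℝ → ℝ)
    (hsol : DoubleDispersion.IsSolution c φ)
    (hpos : ∀ x, 0 < φ x)
    (heven : Function.Even φ)
    (hper : ∃ L : ℝ, 0 < L ∧ Function.Periodic φ L)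
    (hnonconst : ∃ x y, φ x ≠ φ y) :
    ∃ a ∈ DoubleDispersion.rootInterval c,
      ((∀ x, φ x ≤ φ 0) ∧ ∀ x, φ x = DoubleDispersion.dnoidalWave c a x) ∨
      ((∀ x, φ 0 ≤ φ x) ∧
        ∀ x, φ x = DoubleDispersion.dnoidalWave c a (x + DoubleDispersion.period c a / 2)) := by
  have hs : 0 < ss c := by
    obtain ⟨h1, h2⟩ := hc
    rw [ss]
    nlinarith
  obtain ⟨L, hL, hφL⟩ := hper
  obtain ⟨x, y, hmin, hmax⟩ := hφL.exists_forall_ge_and_forall_le hL hsol.1.continuous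
  have hx : deriv φ x = 0 := IsLocalMin.deriv_eq_zero (Filter.Eventually.of_forall hmin)
  have hy : deriv φ y = 0 := IsLocalMax.deriv_eq_zero (Filter.Eventually.of_forall hmax)
  have h0 : deriv φ 0 = 0 := heven.deriv_zero
  have hlt : φ x < φ y := by
    refine lt_of_le_of_ne (hmin y) fun h => ?_
    obtain ⟨u, v, huv⟩ := hnonconst
    exact huv (by linarith [hmin u, hmin v, hmax u, hmax v])
  have hroot := hsol.isRootPair hs hx hy (hpos x) hlt
  refine ⟨φ y ^ 2, hroot.mem_rootInterval, ?_⟩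
  rcases hsol.eq_or_eq_of_deriv_eq_zero hs hpos hx hy h0 hlt with h | h
  · refine Or.inr ⟨fun z => h ▸ hmin z, hroot.eq_dnoidalWave hs hsol _ ?_ ?_⟩
    · rw [hroot.dnoidalWave_half_period hs, Real.sqrt_sq (hpos x).le, h]
    · rw [hroot.dnoidalWaveDeriv_half_period hs, h0]
  · refine Or.inl ⟨fun z => h ▸ hmax z, fun z => ?_⟩
    have := hroot.eq_dnoidalWave hs hsol 0 (by
      rw [hroot.dnoidalWave_zero, Real.sqrt_sq (hpos y).le, h]) (by
      rw [hroot.dnoidalWaveDeriv_zero, h0]) z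
    rwa [add_zero] at this
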